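/- Let $\mathcal H$, $\mathcal H^A$, $\mathcal H^B$, $\mathcal K$ be finite-dimensional complex Hilbert spaces with an orthogonal decomposition $\mathcal H = (\mathcal H^A\otimes\mathcal H^B)\oplus\mathcal K$. Operators on $\mathcal H^A\otimes\mathcal H^B$ are regarded as operators on $\mathcal H$ that vanish on $\mathcal K$. Let $\{|\alpha_k\rangle : 1\le k\le m\}$ be an orthonormal basis of $\mathcal H^A$, put $P_{kl}=|\alpha_k\rangle\langle\alpha_l|\otimes 1^B\in\mathcal B(\mathcal H)$ and $P_k=P_{kk}$, let $P_{\mathfrak A}=\sum_k P_k$ be the orthogonal projection of $\mathcal H$ onto $\mathcal H^A\otimes\mathcal H^B$, and put $\mathcal P_{\mathfrak A}(\cdot)=P_{\mathfrak A}(\cdot)P_{\mathfrak A}$. Let $\mathrm{Tr}_A$ be the partial trace over $\mathcal H^A$, determined by $\mathrm{Tr}_A(\sigma^A\otimes\sigma^B)=\mathrm{Tr}(\sigma^A)\,\sigma^B$, and let $$\mathfrak A=\{\sigma\in\mathcal B(\mathcal H) : \sigma=\sigma^A\otimes\sigma^B \text{ for some } \sigma^A\in\mathcal B(\mathcal H^A),\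 \sigma^B\in\mathcal B(\mathcal H^B)\}.$$ A quantum operation on $\mathcal B(\mathcal H)$ is a completely positive, trace preserving linear map $\mathcal B(\mathcal H)\to\mathcal B(\mathcal H)$. Let $\mathcal E$ be a quantum operation on $\mathcal B(\mathcal H)$ and let $\{E_a\}$ be a finite family of operators on $\mathcal H$ with $\mathcal E(\rho)=\sum_a E_a\rho E_a^\dagger$ for all $\rho\in\mathcal B(\mathcal H)$. The $\mathcal H^B$ sector of $\mathfrak A$ is called correctable for $\mathcal E$ if there is a quantum operation $\mathcal R$ on $\mathcal B(\mathcal H)$ such that $$(\mathrm{Tr}_A\circ\mathcal P_{\mathfrak A}\circ\mathcal R\circ\mathcal E)(\sigma)=\mathrm{Tr}_A(\sigma)\qquad\text{for all }\sigma\in\mathfrak A.$$ Theorem. The $\mathcal H^B$ sector of $\mathfrak A$ is correctable for $\mathcal E$ if and only if there are scalars $\lambda_{abkl}\in\mathbb C$ such that $$P_k E_a^\dagger E_b P_l=\lambda_{abkl}\,P_{kl}\qquad\text{for all } a,b,k,l.$$ -/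

import Mathlib

open scoped TensorProduct

noncomputable section

namespace OperatorQEC

/-- A quantum operation on `𝓑(H)`: a completely positive, trace preserving linear map. -/
structure QuantumOperation (H : Type*) [NormedAddCommGroup H] [InnerProductSpace ℂ H]
    [CompleteSpace H] extends CompletelyPositiveMap (H →L[ℂ] H) (H →L[ℂ] H) where
  trace_map' : ∀ ρ : H →L[ℂ] H,
    LinearMap.trace ℂ H (toFun ρ).toLinearMap = LinearMap.trace ℂ H ρ.toLinearMap

instance {H : Type*} [NormedAddCommGroup H] [InnerProductSpace ℂ H] [CompleteSpace H] :
    CoeFun (QuantumOperation H) (fun _ => (H →L[ℂ] H) → (H →L[ℂ] H)) where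
  coe Φ := Φ.toLinearMap

/-- `Φ = {E a}`: the operators `E a` are noise operators for `Φ`, that is
`Φ ρ = ∑ a, E a ρ (E a)†` for every operator `ρ`. -/
def HasErrorModel {H ι : Type*} [NormedAddCommGroup H] [InnerProductSpace ℂ H]
    [CompleteSpace H] [Fintype ι] (Φ : QuantumOperation H) (E : ι → H →L[ℂ] H) : Prop :=
  ∀ ρ : H →L[ℂ] H, Φ ρ = ∑ a, E a * ρ * ContinuousLinearMap.adjoint (E a)

/-- The partial trace over `A` on the operators on `A ⊗ B`, as the linear map induced by
`σA ⊗ σB ↦ Tr(σA) σB` (see `partialTrace_mapL`). -/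
def partialTrace (A B : Type*) [NormedAddCommGroup A] [InnerProductSpace ℂ A]
    [FiniteDimensional ℂ A] [NormedAddCommGroup B] [InnerProductSpace ℂ B]
    [FiniteDimensional ℂ B] :
    ((A ⊗[ℂ] B) →L[ℂ] (A ⊗[ℂ] B)) →ₗ[ℂ] (B →L[ℂ] B) :=
  LinearMap.toContinuousLinearMap.toLinearMap ∘ₗ
    (TensorProduct.lid ℂ (B →ₗ[ℂ] B)).toLinearMap ∘ₗ
    LinearMap.rTensor (B →ₗ[ℂ] B) (LinearMap.trace ℂ A) ∘ₗ
    (homTensorHomEquiv ℂ A B A B).symm.toLinearMap ∘ₗ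
    ContinuousLinearMap.coeLM ℂ

/-- A decomposition `H = (A ⊗ B) ⊕ K` into an orthogonal direct sum. -/
abbrev Decomposition (A B K H : Type*) [NormedAddCommGroup A] [InnerProductSpace ℂ A]
    [NormedAddCommGroup B] [InnerProductSpace ℂ B] [NormedAddCommGroup K]
    [InnerProductSpace ℂ K] [NormedAddCommGroup H] [InnerProductSpace ℂ H] :=
  WithLp 2 ((A ⊗[ℂ] B) × K) ≃ₗᵢ[ℂ] H

section

variable {A B K H : Type*} [NormedAddCommGroup A] [InnerProductSpace ℂ A]
  [FiniteDimensional ℂ A] [NormedAddCommGroup B] [InnerProductSpace ℂ B]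
  [FiniteDimensional ℂ B] [NormedAddCommGroup K] [InnerProductSpace ℂ K]
  [NormedAddCommGroup H] [InnerProductSpace ℂ H]

/-- The inclusion `A ⊗ B → H` given by the decomposition. -/
def incl (D : Decomposition A B K H) : (A ⊗[ℂ] B) →L[ℂ] H :=
  LinearMap.toContinuousLinearMap
    { toFun := fun x => D (WithLp.toLp 2 (x, 0))
      map_add' := fun x y => by
        rw [← map_add, ← WithLp.toLp_add, Prod.mk_add_mk, add_zero]
      map_smul' := fun c x => by
        rw [RingHom.id_apply, ← map_smul, ← WithLp.toLp_smul, Prod.smul_mk, smul_zero] }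

/-- The orthogonal projection of `H` onto the summand `A ⊗ B`, as a map to `A ⊗ B`. -/
def proj (D : Decomposition A B K H) : H →L[ℂ] (A ⊗[ℂ] B) :=
  WithLp.fstL 2 ℂ (A ⊗[ℂ] B) K ∘L
    (D.symm.toContinuousLinearEquiv : H →L[ℂ] WithLp 2 ((A ⊗[ℂ] B) × K))

/-- An operator on `A ⊗ B`, regarded as an operator on `H` that vanishes on `K`. -/
def embed (D : Decomposition A B K H) (T : (A ⊗[ℂ] B) →L[ℂ] (A ⊗[ℂ] B)) : H →L[ℂ] H :=
  incl D ∘L T ∘L proj D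

/-- The semigroup `𝔄` of all operators on `H` of the form `σA ⊗ σB`. -/
def semigroup (D : Decomposition A B K H) : Set (H →L[ℂ] H) :=
  {σ | ∃ (σA : A →L[ℂ] A) (σB : B →L[ℂ] B), σ = embed D (TensorProduct.mapL σA σB)}

/-- The matrix units `P k l = |α k⟩⟨α l| ⊗ 1` attached to an orthonormal basis `α` of `A`. -/
def matrixUnit {m : ℕ} (D : Decomposition A B K H) (α : OrthonormalBasis (Fin m) ℂ A)
    (k l : Fin m) : H →L[ℂ] H :=
  embed D (TensorProduct.mapL (InnerProductSpace.rankOne ℂ (α k) (α l))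
    (ContinuousLinearMap.id ℂ B))

/-- The projection `P_𝔄` of `H` onto `A ⊗ B` (it is the sum of the `P k k`, see
`sum_matrixUnit`). -/
def codeProj (D : Decomposition A B K H) : H →L[ℂ] H :=
  embed D (ContinuousLinearMap.id ℂ (A ⊗[ℂ] B))

/-- `Tr_A` for operators on `H` supported on the summand `A ⊗ B`. -/
def trA (D : Decomposition A B K H) (T : H →L[ℂ] H) : B →L[ℂ] B :=
  partialTrace A B (proj D ∘L T ∘L incl D)

/-- The `B` sector of the semigroup `𝔄` is correctable for `Φ`: some quantum operation `R`
satisfies `(Tr_A ∘ 𝓟_𝔄 ∘ R ∘ Φ)(σ) = Tr_A(σ)` for all `σ ∈ 𝔄`, where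
`𝓟_𝔄(T) = P_𝔄 T P_𝔄`. -/
def IsCorrectable [CompleteSpace H] (D : Decomposition A B K H) (Φ : QuantumOperation H) :
    Prop :=
  ∃ R : QuantumOperation H, ∀ σ ∈ semigroup D,
    trA D (codeProj D * R (Φ σ) * codeProj D) = trA D σ

theorem partialTrace_mapL (σA : A →L[ℂ] A) (σB : B →L[ℂ] B) :
    partialTrace A B (TensorProduct.mapL σA σB)
      = LinearMap.trace ℂ A σA.toLinearMap • σB := by
  have h : (homTensorHomEquiv ℂ A B A B).symm
      (TensorProduct.map σA.toLinearMap σB.toLinearMap)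
        = σA.toLinearMap ⊗ₜ[ℂ] σB.toLinearMap := by
    rw [LinearEquiv.symm_apply_eq]
    simp
  ext b
  simp [partialTrace, h]

theorem proj_incl (D : Decomposition A B K H) (x : A ⊗[ℂ] B) : proj D (incl D x) = x := by
  simp [proj, incl]

theorem sum_matrixUnit {m : ℕ} (D : Decomposition A B K H)
    (α : OrthonormalBasis (Fin m) ℂ A) : ∑ k, matrixUnit D α k k = codeProj D := by
  ext x
  simp only [matrixUnit, codeProj, embed, sum_apply,
    ContinuousLinearMap.comp_apply, ContinuousLinearMap.id_apply]
  rw [← map_sum]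
  congr 1
  generalize proj D x = y
  induction y using TensorProduct.induction_on with
  | zero => simp
  | tmul a b =>
    simp only [TensorProduct.mapL_tmul, ContinuousLinearMap.id_apply]
    rw [← TensorProduct.sum_tmul]
    congr 1
    simpa using α.sum_repr' a
  | add y z hy hz => simp only [map_add, Finset.sum_add_distrib, hy, hz]

end

end OperatorQEC

end

/-!
Write `J k b = α k ⊗ b` for the slices of the summand `A ⊗ B` of `H`, so that `P k l = J k (J l)†`.
Then `P k (E a)† E b P l = c P k l` says exactly that `(E a ∘ J k)† (E b ∘ J l)` is the scalar `c`
(`matrixUnit_condition_iff`).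

Suppose that `R` restores the `B` sector. For a unit vector `b` of `B`, the functional
`f X = ⟨b, Tr_A(R(X)) b⟩` satisfies `0 ≤ f ≤ Tr` on positive operators. It equals the trace on
`Φ(|α k ⊗ b⟩⟨α k ⊗ b|)`, and it vanishes on `Φ(|α l ⊗ b'⟩⟨α l ⊗ b'|)` if `b' ⟂ b`. These operators
are sums of rank-one operators, so the same holds for each summand, and the vectors
`E i (α k ⊗ b)` and `E j (α l ⊗ b')` are orthogonal (`inner_eq_zero_of_separating`). Hence
`(E i ∘ J k)† (E j ∘ J l)` preserves every line of `B` and is a scalar. Only the positivity of `R`,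
not a Kraus decomposition, enters here.

Conversely, if all products `(V p)† V q` of the maps `V (a, k) = E a ∘ J k` are scalars, then the
`V p` are combinations of isometries `S j : B → H` with mutually orthogonal ranges
(`exists_isometries_of_scalar_gram`). The operation `R` with Kraus operators `J₀ (S j)†`, where
`J₀ b = a₀ ⊗ b` for a fixed unit vector `a₀`, together with the projection onto the orthogonal
complement of the ranges (`exists_kraus_of_scalar_gram`), sends `V p τ (V q)†` to a multiple of
`J₀ τ J₀†`. Trace preservation of `R` and `Φ` shows that the total multiple is the trace of the `A`
factor, which is what correctability asks for.
-/

open scoped TensorProduct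

noncomputable section

namespace OperatorQEC

open ContinuousLinearMap InnerProductSpace
open scoped ComplexOrder

/-! ### Positive functionals and orthogonality -/

section General

variable {B H : Type*} [NormedAddCommGroup B] [InnerProductSpace ℂ B]
  [NormedAddCommGroup H] [InnerProductSpace ℂ H]

/-- If `X` and `Y` send orthogonal pairs to orthogonal pairs, then `X† Y` is a scalar: every vector
`b'` is an eigenvector, since `X† Y b'` lies in `{b'}ᗮᗮ = ℂ b'`. -/
theorem exists_inner_eq_of_orthogonal_preserving [CompleteSpace B] [CompleteSpace H]
    (X Y : B →L[ℂ] H) (h : ∀ b b' : B, inner ℂ b b' = 0 → inner ℂ (X b) (Y b') = 0) :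
    ∃ c : ℂ, ∀ b b' : B, inner ℂ (X b) (Y b') = c * inner ℂ b b' := by
  have hM : ∀ b' : B, (adjoint X ∘L Y) b' ∈ Submodule.span ℂ {b'} := by
    intro b'
    rw [← Submodule.orthogonal_orthogonal (Submodule.span ℂ {b'}), Submodule.mem_orthogonal]
    intro b hb
    rw [Submodule.mem_orthogonal_singleton_iff_inner_left] at hb
    rw [comp_apply, adjoint_inner_right]
    exact h b b' hb
  obtain ⟨c, hc⟩ :=
    (adjoint X ∘L Y).toLinearMap.exists_eq_smul_id_of_forall_notLinearIndependent fun b => by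
      obtain ⟨t, ht⟩ := Submodule.mem_span_singleton.mp (hM b)
      intro hli
      have := (LinearIndependent.pair_iff.mp hli) t (-1) (by simp [ht])
      simp at this
  refine ⟨c, fun b b' => ?_⟩
  have := congrArg (fun T => inner ℂ b (T b')) hc
  simpa [adjoint_inner_right, inner_smul_right] using this

/-- The Cauchy–Schwarz inequality `|f(|w⟩⟨v|)|² ≤ f(|w⟩⟨w|) f(|v⟩⟨v|)` for a positive functional, in
the degenerate case where one factor on the right vanishes. -/
theorem map_rankOne_eq_zero_of_self (f : (H →L[ℂ] H) →ₗ[ℂ] ℂ)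
    (hf : ∀ x : H, 0 ≤ f (rankOne ℂ x x)) {w : H} (hw : f (rankOne ℂ w w) = 0) (v : H) :
    f (rankOne ℂ w v) = 0 ∧ f (rankOne ℂ v w) = 0 := by
  have key : ∀ t : ℂ, 0 ≤ t * f (rankOne ℂ w v) + star t * f (rankOne ℂ v w)
      + f (rankOne ℂ v v) := by
    intro t
    have := hf (t • w + v)
    simpa [hw, add_assoc] using this
  set p := f (rankOne ℂ w v)
  set q := f (rankOne ℂ v w)
  obtain ⟨hr, hi⟩ := Complex.le_def.mp (hf v)
  -- real and imaginary parts of `key` at `t = s` and at `t = s * I`, with `s` real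
  have h1 : ∀ s : ℝ, 0 ≤ s * (p.re + q.re) + (f (rankOne ℂ v v)).re ∧ s * (p.im + q.im) = 0 := by
    intro s
    obtain ⟨a, b⟩ := Complex.le_def.mp (key s)
    simp at a b hi
    constructor <;> linarith
  have h2 : ∀ s : ℝ, 0 ≤ s * (q.im - p.im) + (f (rankOne ℂ v v)).re ∧ s * (p.re - q.re) = 0 := by
    intro s
    obtain ⟨a, b⟩ := Complex.le_def.mp (key (s * Complex.I))
    simp at a b hi
    constructor <;> linarith
  -- an affine function that is bounded below on the real line has slope zero
  have aff : ∀ a b : ℝ, (∀ s : ℝ, 0 ≤ s * a + b) → a = 0 := by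
    intro a b h
    by_contra ha
    have := h (-(b + 1) / a)
    rw [div_mul_cancel₀ _ ha] at this
    linarith
  have e1 := aff _ _ fun s => (h1 s).1
  have e2 := aff _ _ fun s => (h2 s).1
  have e3 := (h1 1).2
  have e4 := (h2 1).2
  constructor <;> apply Complex.ext <;> simp <;> linarith

/-- If a functional `f` with `0 ≤ f ≤ Tr` takes its largest possible value at `|v⟩⟨v|` and vanishes
at `|w⟩⟨w|`, then `v ⟂ w`: both `f` and `Tr - f` are positive and degenerate at one of the two
vectors, so both vanish at `|w⟩⟨v|`, whose trace is `⟨v, w⟩`. -/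
theorem inner_eq_zero_of_separating [FiniteDimensional ℂ H] (f : (H →L[ℂ] H) →ₗ[ℂ] ℂ)
    (hf : ∀ x : H, 0 ≤ f (rankOne ℂ x x))
    (hf' : ∀ x : H, f (rankOne ℂ x x) ≤ inner ℂ x x) {v w : H}
    (hv : f (rankOne ℂ v v) = inner ℂ v v) (hw : f (rankOne ℂ w w) = 0) :
    inner ℂ v w = 0 := by
  have h1 := (map_rankOne_eq_zero_of_self f hf hw v).1
  let g : (H →L[ℂ] H) →ₗ[ℂ] ℂ := LinearMap.trace ℂ H ∘ₗ coeLM ℂ - f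
  have hg : ∀ x y, g (rankOne ℂ x y) = inner ℂ y x - f (rankOne ℂ x y) := by
    intro x y
    simp [g, trace_rankOne]
  have h2 := (map_rankOne_eq_zero_of_self g (fun x => by rw [hg]; exact sub_nonneg.mpr (hf' x))
    (w := v) (by rw [hg, hv, sub_self]) w).2
  rwa [hg, h1, sub_zero] at h2

end General

/-! ### Operator-sum quantum operations -/

section Kraus

variable {H : Type*} [NormedAddCommGroup H] [InnerProductSpace ℂ H] [CompleteSpace H]

theorem trace_conj (F ρ : H →L[ℂ] H) :
    LinearMap.trace ℂ H (F * ρ * adjoint F).toLinearMap =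
      LinearMap.trace ℂ H (adjoint F * F * ρ).toLinearMap := by
  rw [mul_assoc, mul_assoc]
  exact LinearMap.trace_mul_cycle' ℂ F.toLinearMap ρ.toLinearMap (adjoint F).toLinearMap

/-- Conjugation by `F` is completely positive: entrywise it is conjugation of the matrix by
`diag(F, …, F)`. -/
theorem cstarMatrix_map_conj_nonneg {k : ℕ} (F : H →L[ℂ] H)
    (M : CStarMatrix (Fin k) (Fin k) (H →L[ℂ] H)) (hM : 0 ≤ M) :
    0 ≤ M.map fun ρ => F * ρ * adjoint F := by
  let G : CStarMatrix (Fin k) (Fin k) (H →L[ℂ] H) :=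
    CStarMatrix.ofMatrix (Matrix.diagonal fun _ => F)
  have h : M.map (fun ρ => F * ρ * adjoint F) = G * M * star G := by
    ext1 i j
    have h1 : ∀ a, (G * M) i a = F * M i a := fun a =>
      Matrix.diagonal_mul (fun _ => F) (M : Matrix _ _ (H →L[ℂ] H)) i a
    have h2 : star G = CStarMatrix.ofMatrix (Matrix.diagonal fun _ => adjoint F) :=
      Matrix.diagonal_conjTranspose _
    rw [h2]
    exact ((Matrix.mul_diagonal (fun _ => adjoint F) (G * M : Matrix _ _ (H →L[ℂ] H)) i j).trans
      (by rw [h1]; rfl)).symm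
  rw [h]
  exact star_right_conjugate_nonneg hM G

/-- The quantum operation `ρ ↦ ∑ j, F j ρ (F j)†` of a finite family with `∑ j, (F j)† F j = 1`. -/
def krausOperation {κ : Type*} [Fintype κ] (F : κ → H →L[ℂ] H)
    (hF : ∑ j, adjoint (F j) * F j = 1) : QuantumOperation H where
  toFun ρ := ∑ j, F j * ρ * adjoint (F j)
  map_add' ρ σ := by simp only [mul_add, add_mul, Finset.sum_add_distrib]
  map_smul' c ρ := by simp [Finset.smul_sum]
  map_cstarMatrix_nonneg' k M hM := by
    have h : M.map (fun ρ => ∑ j, F j * ρ * adjoint (F j)) =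
        ∑ j, M.map fun ρ => F j * ρ * adjoint (F j) := by
      ext1 i l
      exact (Matrix.sum_apply i l Finset.univ
        fun j => (M.map fun ρ => F j * ρ * adjoint (F j) : Matrix _ _ (H →L[ℂ] H))).symm
    exact h ▸ Finset.sum_nonneg fun j _ => cstarMatrix_map_conj_nonneg (F j) M hM
  trace_map' ρ := by
    have h : (∑ j, F j * ρ * adjoint (F j)).toLinearMap =
      ∑ j, (F j * ρ * adjoint (F j)).toLinearMap := by ext; simp
    change LinearMap.trace ℂ H (∑ j, F j * ρ * adjoint (F j)).toLinearMap = _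
    rw [h, map_sum, Finset.sum_congr rfl fun j _ => trace_conj (F j) ρ, ← map_sum]
    have h' : ∑ j, (adjoint (F j) * F j * ρ).toLinearMap =
      ((∑ j, adjoint (F j) * F j) * ρ).toLinearMap := by
        rw [Finset.sum_mul]
        ext; simp
    rw [h', hF, one_mul]

theorem krausOperation_apply {κ : Type*} [Fintype κ] (F : κ → H →L[ℂ] H)
    (hF : ∑ j, adjoint (F j) * F j = 1) (ρ : H →L[ℂ] H) :
    krausOperation F hF ρ = ∑ j, F j * ρ * adjoint (F j) := rfl

theorem conj_rankOne (F : H →L[ℂ] H) (x y : H) :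
    F * rankOne ℂ x y * adjoint F = rankOne ℂ (F x) (F y) := by
  ext z
  simp [adjoint_inner_right]

theorem QuantumOperation.isPositive_apply_rankOne (R : QuantumOperation H) (x : H) :
    (R (rankOne ℂ x x)).IsPositive := by
  rw [← nonneg_iff_isPositive]
  exact map_nonneg R.toCompletelyPositiveMap
    ((nonneg_iff_isPositive _).mpr (isPositive_rankOne_self x))

theorem HasErrorModel.apply_rankOne {ι : Type*} [Fintype ι] {Φ : QuantumOperation H}
    {E : ι → H →L[ℂ] H} (hE : HasErrorModel Φ E) (x y : H) :
    Φ (rankOne ℂ x y) = ∑ a, rankOne ℂ (E a x) (E a y) := by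
  rw [hE]
  simp only [conj_rankOne]

end Kraus

/-! ### Kraus operators of the recovery operation -/

section Recovery

variable {B H : Type*} [NormedAddCommGroup B] [InnerProductSpace ℂ B]
  [NormedAddCommGroup H] [InnerProductSpace ℂ H]

/-- If all `(V p)† V q` are scalars, then the `V p` are linear combinations of finitely many
isometries with mutually orthogonal ranges. Every `T† T'` with `T`, `T'` in the span of the `V p` is
a scalar, so evaluation at a unit vector `b₀` is injective on this span; the isometries are the
preimages of an orthonormal basis of its image in `H`. -/
theorem exists_isometries_of_scalar_gram [Nontrivial B] [FiniteDimensional ℂ H] {P : Type*}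
    (V : P → B →L[ℂ] H)
    (hV : ∀ p q, ∃ t : ℂ, ∀ b b' : B, inner ℂ (V p b) (V q b') = t * inner ℂ b b') :
    ∃ (n : ℕ) (S : Fin n → B →L[ℂ] H) (c : P → Fin n → ℂ),
      (∀ i j b b', inner ℂ (S i b) (S j b') = if i = j then inner ℂ b b' else 0) ∧
      ∀ p, V p = ∑ j, c p j • S j := by
  obtain ⟨b₀, hb₀⟩ := exists_norm_eq B zero_le_one
  have hb₀' : inner ℂ b₀ b₀ = (1 : ℂ) := by simp [inner_self_eq_norm_sq_to_K, hb₀]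
  let 𝒱 : Submodule ℂ (B →L[ℂ] H) := Submodule.span ℂ (Set.range V)
  have hspan : ∀ T ∈ 𝒱, ∀ T' ∈ 𝒱, ∃ t : ℂ, ∀ b b' : B,
      inner ℂ (T b) (T' b') = t * inner ℂ b b' := by
    intro T hT T' hT'
    induction hT, hT' using Submodule.span_induction₂ with
    | mem_mem x y hx hy =>
      obtain ⟨p, rfl⟩ := hx
      obtain ⟨q, rfl⟩ := hy
      exact hV p q
    | zero_left y hy => exact ⟨0, by simp⟩
    | zero_right x hx => exact ⟨0, by simp⟩
    | add_left x y z _ _ _ h₁ h₂ =>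
      obtain ⟨s, hs⟩ := h₁
      obtain ⟨t, ht⟩ := h₂
      exact ⟨s + t, fun b b' => by simp [hs, ht, add_mul]⟩
    | add_right x y z _ _ _ h₁ h₂ =>
      obtain ⟨s, hs⟩ := h₁
      obtain ⟨t, ht⟩ := h₂
      exact ⟨s + t, fun b b' => by simp [hs, ht, add_mul]⟩
    | smul_left r x y _ _ h =>
      obtain ⟨s, hs⟩ := h
      exact ⟨star r * s, fun b b' => by simp [hs, mul_assoc, mul_left_comm, mul_comm]⟩
    | smul_right r x y _ _ h =>
      obtain ⟨s, hs⟩ := h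
      exact ⟨r * s, fun b b' => by simp [hs, mul_assoc]⟩
  have hev : ∀ T ∈ 𝒱, ∀ T' ∈ 𝒱, ∀ b b' : B,
      inner ℂ (T b) (T' b') = inner ℂ (T b₀) (T' b₀) * inner ℂ b b' := by
    intro T hT T' hT' b b'
    obtain ⟨t, ht⟩ := hspan T hT T' hT'
    rw [ht, ht, hb₀', mul_one]
  let ev : (B →L[ℂ] H) →ₗ[ℂ] H := LinearMap.applyₗ b₀ ∘ₗ coeLM ℂ
  let s := stdOrthonormalBasis ℂ (𝒱.map ev)
  choose S hS hS' using fun i => Submodule.mem_map.mp (s i).2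
  have hSb : ∀ i, S i b₀ = s i := hS'
  refine ⟨_, S, fun p j => inner ℂ (s j : H) (V p b₀), fun i j b b' => ?_, fun p => ?_⟩
  · rw [hev _ (hS i) _ (hS j), hSb, hSb, ← Submodule.coe_inner,
      orthonormal_iff_ite.mp s.orthonormal i j]
    split_ifs <;> simp
  -- the difference of the two sides lies in `𝒱` and vanishes at `b₀`, hence it is zero
  · have hp : V p ∈ 𝒱 := Submodule.subset_span ⟨p, rfl⟩
    set W := V p - ∑ j, inner ℂ (s j : H) (V p b₀) • S j with hW
    have hWm : W ∈ 𝒱 :=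
      𝒱.sub_mem hp (𝒱.sum_mem fun j _ => 𝒱.smul_mem _ (hS j))
    have hW0 : W b₀ = 0 := by
      have := congrArg (Subtype.val) (s.sum_repr' ⟨V p b₀, Submodule.mem_map_of_mem (f := ev) hp⟩)
      simp only [Submodule.coe_sum, Submodule.coe_smul, Submodule.coe_inner] at this
      simp [hW, hSb, this]
    rw [← sub_eq_zero, ← hW]
    ext b
    rw [zero_apply, ← inner_self_eq_zero (𝕜 := ℂ), hev W hWm W hWm, hW0, inner_zero_left, zero_mul]

/-- If all `(V p)† V q` are scalars and `J` is an isometry, then there are Kraus operators `F j` of a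
quantum operation such that each `F j ∘ V p` is a multiple of `J`.
With isometries `S j` as in `exists_isometries_of_scalar_gram`, the Kraus operators are `J (S j)†`
and the projection onto the complement of the ranges of the `S j`, which annihilates every `V p`. -/
theorem exists_kraus_of_scalar_gram [Nontrivial B] [CompleteSpace B] [FiniteDimensional ℂ H]
    [CompleteSpace H] {P : Type*} (V : P → B →L[ℂ] H)
    (hV : ∀ p q, ∃ t : ℂ, ∀ b b' : B, inner ℂ (V p b) (V q b') = t * inner ℂ b b')
    (J : B →L[ℂ] H) (hJ : ∀ b b', inner ℂ (J b) (J b') = inner ℂ b b') :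
    ∃ (n : ℕ) (F : Option (Fin n) → H →L[ℂ] H) (c : P → Option (Fin n) → ℂ),
      ∑ j, adjoint (F j) * F j = 1 ∧ ∀ p j b, F j (V p b) = c p j • J b := by
  obtain ⟨n, S, c, hS, hc⟩ := exists_isometries_of_scalar_gram V hV
  have hSS : ∀ i j b, adjoint (S i) (S j b) = if i = j then b else 0 := by
    intro i j b
    refine ext_inner_left ℂ fun b' => ?_
    rw [adjoint_inner_right, hS]
    split_ifs <;> simp
  have hJJ : ∀ b, adjoint J (J b) = b := fun b => ext_inner_left ℂ fun b' => by
    rw [adjoint_inner_right, hJ]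
  let Q : H →L[ℂ] H := 1 - ∑ j, S j ∘L adjoint (S j)
  have hQS : ∀ j b, Q (S j b) = 0 := by
    intro j b
    have h : ∀ i, S i (adjoint (S i) (S j b)) = if i = j then S j b else 0 := by
      intro i
      rw [hSS]
      split_ifs with hij <;> simp [hij]
    simp [Q, h]
  have hQa : adjoint Q = Q := by
    simp only [Q, map_sub, map_sum, adjoint_comp, adjoint_adjoint, one_def, adjoint_id]
  have hQQ : Q * Q = Q := by
    ext x
    have h : Q x = x - ∑ j, S j (adjoint (S j) x) := by simp [Q]
    rw [mul_apply_eq_comp]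
    conv_lhs => rw [h]
    simp [hQS]
  refine ⟨n, fun j => j.elim Q fun j => J ∘L adjoint (S j), fun p j => j.elim 0 (c p), ?_, ?_⟩
  · rw [Fintype.sum_option]
    ext x
    simp only [Option.elim, hQa, hQQ]
    simp [Q, adjoint_comp, hJJ]
  · rintro p (_ | j) b
    · simp [hc, hQS]
    · have h : ∀ i, J (adjoint (S j) (S i b)) = if j = i then J b else 0 := by
        intro i
        rw [hSS]
        split_ifs <;> simp
      simp [hc, h]

end Recovery

/-! ### Slices of the tensor summand and the partial trace -/

section Sector

variable {A B K H : Type*} [NormedAddCommGroup A] [InnerProductSpace ℂ A]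
  [FiniteDimensional ℂ A] [NormedAddCommGroup B] [InnerProductSpace ℂ B]
  [FiniteDimensional ℂ B] [NormedAddCommGroup K] [InnerProductSpace ℂ K]
  [NormedAddCommGroup H] [InnerProductSpace ℂ H]

theorem inner_incl_incl (D : Decomposition A B K H) (x y : A ⊗[ℂ] B) :
    inner ℂ (incl D x) (incl D y) = inner ℂ x y := by
  simp [incl]

theorem inner_incl_left (D : Decomposition A B K H) (x : A ⊗[ℂ] B) (y : H) :
    inner ℂ (incl D x) y = inner ℂ x (proj D y) := by
  have h : inner ℂ (incl D x) (D (D.symm y)) = inner ℂ x (proj D y) := by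
    simp [incl, proj, -LinearIsometryEquiv.apply_symm_apply]
  simpa using h

/-- The map `b ↦ a ⊗ b` from `B` into `H`, through the summand `A ⊗ B`. It is an isometry if `a` is
a unit vector. -/
def slice (D : Decomposition A B K H) (a : A) : B →L[ℂ] H :=
  incl D ∘L LinearMap.toContinuousLinearMap (TensorProduct.mk ℂ A B a)

theorem slice_apply (D : Decomposition A B K H) (a : A) (b : B) :
    slice D a b = incl D (a ⊗ₜ b) := rfl

theorem inner_slice_slice (D : Decomposition A B K H) (a a' : A) (b b' : B) :
    inner ℂ (slice D a b) (slice D a' b') = inner ℂ a a' * inner ℂ b b' := by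
  rw [slice_apply, slice_apply, inner_incl_incl, TensorProduct.inner_tmul]

theorem embed_mapL_rankOne (D : Decomposition A B K H) (a a' : A) (b b' : B) :
    embed D (TensorProduct.mapL (rankOne ℂ a a') (rankOne ℂ b b')) =
      rankOne ℂ (slice D a b) (slice D a' b') := by
  ext x
  rw [rankOne_apply, slice_apply, slice_apply, inner_incl_left, embed, comp_apply, comp_apply,
    ← map_smul]
  congr 1
  generalize proj D x = y
  induction y using TensorProduct.induction_on with
  | zero => simp
  | tmul u v =>
    rw [TensorProduct.mapL_tmul, rankOne_apply, rankOne_apply, TensorProduct.smul_tmul_smul,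
      TensorProduct.inner_tmul]
  | add y z hy hz => rw [map_add, hy, hz, inner_add_right, add_smul]

theorem rankOne_slice_mem_semigroup (D : Decomposition A B K H) (a a' : A) (b b' : B) :
    rankOne ℂ (slice D a b) (slice D a' b') ∈ semigroup D :=
  ⟨_, _, (embed_mapL_rankOne D a a' b b').symm⟩

theorem eq_sum_rankOne {E ι' : Type*} [NormedAddCommGroup E] [InnerProductSpace ℂ E] [Fintype ι']
    (β : OrthonormalBasis ι' ℂ E) (T : E →L[ℂ] E) : T = ∑ i, rankOne ℂ (T (β i)) (β i) := by
  conv_lhs => rw [← comp_id T, ← β.sum_rankOne_eq_id, comp_finsetSum]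
  simp [comp_rankOne]

theorem semigroup_subset_span {m : ℕ} (D : Decomposition A B K H)
    (α : OrthonormalBasis (Fin m) ℂ A) :
    semigroup D ⊆ Submodule.span ℂ
      {T | ∃ k l b b', T = rankOne ℂ (slice D (α k) b) (slice D (α l) b')} := by
  rintro _ ⟨σA, σB, rfl⟩
  let β := stdOrthonormalBasis ℂ B
  have hsum : TensorProduct.mapL σA σB = ∑ l, ∑ i,
      TensorProduct.mapL (rankOne ℂ (σA (α l)) (α l)) (rankOne ℂ (σB (β i)) (β i)) := by
    ext y
    induction y using TensorProduct.induction_on with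
    | zero => simp
    | tmul u v =>
      simp only [sum_apply, TensorProduct.mapL_tmul, ← TensorProduct.tmul_sum,
        ← TensorProduct.sum_tmul]
      simp only [← sum_apply, ← eq_sum_rankOne]
    | add y z hy hz => rw [map_add, hy, hz, map_add]
  have hembed : embed D (TensorProduct.mapL σA σB) = ∑ l, ∑ i,
      rankOne ℂ (slice D (σA (α l)) (σB (β i))) (slice D (α l) (β i)) := by
    simp only [← embed_mapL_rankOne]
    rw [hsum]
    ext x
    simp [embed]
  rw [hembed]
  refine Submodule.sum_mem _ fun l _ => Submodule.sum_mem _ fun i _ => ?_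
  have hslice : slice D (σA (α l)) (σB (β i)) =
      ∑ k, inner ℂ (α k) (σA (α l)) • slice D (α k) (σB (β i)) := by
    conv_lhs => rw [← α.sum_repr' (σA (α l))]
    simp [slice_apply, TensorProduct.sum_tmul, ← TensorProduct.smul_tmul']
  rw [hslice, map_sum, sum_apply]
  refine Submodule.sum_mem _ fun k _ => ?_
  rw [map_smul, smul_apply]
  exact Submodule.smul_mem _ _ (Submodule.subset_span ⟨k, l, _, _, rfl⟩)

/-- `trA` as a linear map. -/
def trALinear (D : Decomposition A B K H) : (H →L[ℂ] H) →ₗ[ℂ] (B →L[ℂ] B) where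
  toFun := trA D
  map_add' S T := by simp [trA]
  map_smul' c T := by simp [trA]

/-- The matrix entries of the partial trace, computed in an orthonormal basis of `A`. -/
theorem inner_partialTrace {m : ℕ} (α : OrthonormalBasis (Fin m) ℂ A)
    (T : (A ⊗[ℂ] B) →L[ℂ] (A ⊗[ℂ] B)) (b b' : B) :
    inner ℂ b (partialTrace A B T b') = ∑ k, inner ℂ (α k ⊗ₜ[ℂ] b) (T (α k ⊗ₜ[ℂ] b')) := by
  obtain ⟨z, hz⟩ := (homTensorHomEquiv ℂ A B A B).surjective T.toLinearMap
  obtain rfl : T = LinearMap.toContinuousLinearMap (homTensorHomEquiv ℂ A B A B z) := by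
    rw [hz]; rfl
  clear hz
  induction z using TensorProduct.induction_on with
  | zero => simp
  | tmul u v =>
    have h : LinearMap.toContinuousLinearMap (homTensorHomEquiv ℂ A B A B (u ⊗ₜ v)) =
        TensorProduct.mapL (LinearMap.toContinuousLinearMap u)
          (LinearMap.toContinuousLinearMap v) := by
      ext x
      induction x using TensorProduct.induction_on with
      | zero => simp
      | tmul a b => simp
      | add x y hx hy => rw [map_add, hx, hy, map_add]
    rw [h, partialTrace_mapL]
    simp [TensorProduct.inner_tmul, LinearMap.trace_eq_sum_inner _ α,
      Finset.sum_mul]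
  | add y z hy hz =>
    simp only [map_add, add_apply, inner_add_right, hy, hz, Finset.sum_add_distrib]

theorem inner_trA {m : ℕ} (D : Decomposition A B K H) (α : OrthonormalBasis (Fin m) ℂ A)
    (T : H →L[ℂ] H) (b b' : B) :
    inner ℂ b (trA D T b') = ∑ k, inner ℂ (slice D (α k) b) (T (slice D (α k) b')) := by
  simp [trA, inner_partialTrace α, slice_apply, inner_incl_left]

/-- For a positive operator `T` and a unit vector `b`, the number `⟨b, Tr_A(T) b⟩` lies between `0`
and `Tr T`; the upper bound is Bessel's inequality for the orthonormal family `α k ⊗ b`. -/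
theorem inner_trA_self_nonneg_and_le_trace [FiniteDimensional ℂ H] (D : Decomposition A B K H)
    {T : H →L[ℂ] H} (hT : T.IsPositive) {b : B} (hb : ‖b‖ = 1) :
    0 ≤ inner ℂ b (trA D T b) ∧ inner ℂ b (trA D T b) ≤ LinearMap.trace ℂ H T.toLinearMap := by
  let α := stdOrthonormalBasis ℂ A
  have hv : Orthonormal ℂ fun k => slice D (α k) b := by
    rw [orthonormal_iff_ite]
    intro i j
    simp [inner_slice_slice, orthonormal_iff_ite.mp α.orthonormal i j,
      inner_self_eq_norm_sq_to_K, hb]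
  rw [inner_trA D α]
  refine ⟨Finset.sum_nonneg fun k _ => hT.inner_nonneg_right _, ?_⟩
  obtain ⟨n, u, rfl⟩ := isPositive_iff_eq_sum_rankOne.mp hT
  have h' : (∑ i, rankOne ℂ (u i) (u i)).toLinearMap =
      ∑ i, (rankOne ℂ (u i) (u i)).toLinearMap := by ext; simp
  rw [h', map_sum]
  simp only [trace_rankOne, sum_apply, inner_sum, rankOne_apply, inner_smul_right]
  rw [Finset.sum_comm]
  refine Finset.sum_le_sum fun i _ => ?_
  have hbessel := hv.sum_inner_products_le (x := u i) (s := Finset.univ)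
  have h1 : ∀ k, inner ℂ (u i) (slice D (α k) b) * inner ℂ (slice D (α k) b) (u i) =
      ((‖inner ℂ (slice D (α k) b) (u i)‖ ^ 2 : ℝ) : ℂ) := by
    intro k
    rw [← inner_conj_symm, Complex.conj_mul']
    push_cast; rfl
  rw [Finset.sum_congr rfl fun k _ => h1 k, ← Complex.ofReal_sum, inner_self_eq_norm_sq_to_K]
  exact (Complex.real_le_real.mpr hbessel).trans_eq (Complex.ofReal_pow _ _)

theorem trA_conj_codeProj (D : Decomposition A B K H) (T : H →L[ℂ] H) :
    trA D (codeProj D * T * codeProj D) = trA D T := by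
  have h : proj D ∘L (codeProj D * T * codeProj D) ∘L incl D = proj D ∘L T ∘L incl D := by
    ext x
    simp [codeProj, embed, proj_incl]
  rw [trA, h, trA]

theorem trA_rankOne_slice (D : Decomposition A B K H) (a a' : A) (b b' : B) :
    trA D (rankOne ℂ (slice D a b) (slice D a' b')) = inner ℂ a' a • rankOne ℂ b b' := by
  have h : proj D ∘L embed D (TensorProduct.mapL (rankOne ℂ a a') (rankOne ℂ b b')) ∘L incl D =
      TensorProduct.mapL (rankOne ℂ a a') (rankOne ℂ b b') := by
    ext x
    simp [embed, proj_incl]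
  rw [← embed_mapL_rankOne, trA, h, partialTrace_mapL, trace_rankOne]

/-- The matrix units in terms of slices: `P k l = J k (J l)†` with `J k b = α k ⊗ b`. -/
theorem matrixUnit_eq [CompleteSpace B] [CompleteSpace H] {m : ℕ} (D : Decomposition A B K H)
    (α : OrthonormalBasis (Fin m) ℂ A) (k l : Fin m) :
    matrixUnit D α k l = slice D (α k) ∘L adjoint (slice D (α l)) := by
  have hadj : ∀ a x, adjoint (slice D a) x = adjoint (slice D a) (incl D (proj D x)) := by
    intro a x
    refine ext_inner_left ℂ fun b => ?_
    rw [adjoint_inner_right, adjoint_inner_right, slice_apply, inner_incl_left, inner_incl_left,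
      proj_incl]
  ext x
  rw [matrixUnit, embed, comp_apply, comp_apply, comp_apply, hadj]
  generalize proj D x = y
  induction y using TensorProduct.induction_on with
  | zero => simp
  | tmul u v =>
    have h : adjoint (slice D (α l)) (incl D (u ⊗ₜ v)) = inner ℂ (α l) u • v := by
      refine ext_inner_left ℂ fun b => ?_
      rw [adjoint_inner_right, ← slice_apply, inner_slice_slice, inner_smul_right]
    simp [h, slice_apply, TensorProduct.smul_tmul]
  | add y z hy hz => simp only [map_add, hy, hz]

/-- The operator identity `P k X† Y P l = c P k l` says that the slices `X (α k ⊗ ·)` and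
`Y (α l ⊗ ·)` have the scalar `c` as their mutual Gram operator. -/
theorem matrixUnit_condition_iff [CompleteSpace B] [CompleteSpace H] {m : ℕ}
    (D : Decomposition A B K H) (α : OrthonormalBasis (Fin m) ℂ A) (X Y : H →L[ℂ] H)
    (k l : Fin m) (c : ℂ) :
    matrixUnit D α k k * adjoint X * Y * matrixUnit D α l l = c • matrixUnit D α k l ↔
      ∀ b b', inner ℂ (X (slice D (α k) b)) (Y (slice D (α l) b')) = c * inner ℂ b b' := by
  have hs : ∀ k b, adjoint (slice D (α k)) (slice D (α k) b) = b := fun k b =>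
    ext_inner_left ℂ fun b' => by rw [adjoint_inner_right, inner_slice_slice]; simp
  simp only [matrixUnit_eq]
  constructor
  · intro h b b'
    have h1 := congrArg (fun T => inner ℂ (slice D (α k) b) (T (slice D (α l) b'))) h
    simpa [hs, inner_slice_slice, inner_smul_right, adjoint_inner_right] using h1
  · intro h
    have h2 : ∀ b', adjoint (slice D (α k)) (adjoint X (Y (slice D (α l) b'))) = c • b' :=
      fun b' => ext_inner_left ℂ fun b => by
        rw [adjoint_inner_right, adjoint_inner_right, h, inner_smul_right]
    ext x
    simp [h2]

end Sector

/-! ### Correctability of a sector -/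

section Main

variable {A B K H : Type*} [NormedAddCommGroup A] [InnerProductSpace ℂ A]
  [FiniteDimensional ℂ A] [NormedAddCommGroup B] [InnerProductSpace ℂ B]
  [FiniteDimensional ℂ B] [NormedAddCommGroup K] [InnerProductSpace ℂ K]
  [NormedAddCommGroup H] [InnerProductSpace ℂ H] [FiniteDimensional ℂ H] [CompleteSpace H]

/-- Trace preservation of `∑ a, E a (·) (E a)†`, in the form `∑ a, (E a)† E a = 1`. -/
theorem HasErrorModel.sum_inner {ι : Type*} [Fintype ι] {Φ : QuantumOperation H}
    {E : ι → H →L[ℂ] H} (hE : HasErrorModel Φ E) (x y : H) :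
    ∑ a, inner ℂ (E a x) (E a y) = inner ℂ x y := by
  have h := Φ.trace_map' (rankOne ℂ y x)
  rw [trace_rankOne] at h
  rw [← h]
  change _ = LinearMap.trace ℂ H (Φ (rankOne ℂ y x)).toLinearMap
  rw [hE.apply_rankOne]
  have h' : (∑ a, rankOne ℂ (E a y) (E a x)).toLinearMap =
      ∑ a, (rankOne ℂ (E a y) (E a x)).toLinearMap := by ext; simp
  rw [h', map_sum]
  simp only [trace_rankOne]

/-- The functional `X ↦ ⟨b, Tr_A(R(X)) b⟩`: the weight on `b` of the state of the `B` sector after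
the operation `R`. -/
def sectorExpectation (D : Decomposition A B K H) (R : QuantumOperation H) (b : B) :
    (H →L[ℂ] H) →ₗ[ℂ] ℂ where
  toFun X := inner ℂ b (trA D (R X) b)
  map_add' X Y := by simp [trA]
  map_smul' c X := by simp [trA]

/-- If `R` restores the `B` sector, then errors keep orthogonal vectors of `B` orthogonal: the
functional `sectorExpectation D R b` is maximal on the output of `Φ` from `a ⊗ b` and vanishes on
the output from `a' ⊗ b'`. -/
theorem inner_error_eq_zero_of_correctable {ι : Type*} [Fintype ι] (D : Decomposition A B K H)
    {Φ : QuantumOperation H} {E : ι → H →L[ℂ] H} (hE : HasErrorModel Φ E)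
    {R : QuantumOperation H} (hR : ∀ σ ∈ semigroup D, trA D (R (Φ σ)) = trA D σ)
    {a a' : A} (ha : ‖a‖ = 1) {b b' : B} (hb : ‖b‖ = 1) (hbb' : inner ℂ b b' = 0) (i j : ι) :
    inner ℂ (E i (slice D a b)) (E j (slice D a' b')) = 0 := by
  let f := sectorExpectation D R b
  have hbound : ∀ x, 0 ≤ f (rankOne ℂ x x) ∧ f (rankOne ℂ x x) ≤ inner ℂ x x := by
    intro x
    have h := inner_trA_self_nonneg_and_le_trace D (R.isPositive_apply_rankOne x) hb
    have htr := R.trace_map' (rankOne ℂ x x)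
    rw [trace_rankOne] at htr
    exact ⟨h.1, h.2.trans_eq htr⟩
  have hf : ∀ (u : A) (v : B), ∑ a, f (rankOne ℂ (E a (slice D u v)) (E a (slice D u v))) =
      inner ℂ u u * (inner ℂ v b * inner ℂ b v) := by
    intro u v
    rw [← map_sum, ← hE.apply_rankOne]
    change inner ℂ b (trA D (R (Φ _)) b) = _
    rw [hR _ (rankOne_slice_mem_semigroup D u u v v), trA_rankOne_slice]
    simp
  have hbb : inner ℂ b b = (1 : ℂ) := by simp [inner_self_eq_norm_sq_to_K, hb]
  have haa : inner ℂ a a = (1 : ℂ) := by simp [inner_self_eq_norm_sq_to_K, ha]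
  -- in both cases a sum of nonnegative terms over the error operators vanishes
  refine inner_eq_zero_of_separating f (fun x => (hbound x).1) (fun x => (hbound x).2) ?_ ?_
  · have hsum : ∑ a_1, (inner ℂ (E a_1 (slice D a b)) (E a_1 (slice D a b)) -
        f (rankOne ℂ (E a_1 (slice D a b)) (E a_1 (slice D a b)))) = 0 := by
      rw [Finset.sum_sub_distrib, hf, hE.sum_inner, inner_slice_slice]
      rw [hbb, haa]
      norm_num
    rw [Finset.sum_eq_zero_iff_of_nonneg fun x _ => sub_nonneg.mpr (hbound _).2] at hsum
    exact (sub_eq_zero.mp (hsum i (Finset.mem_univ i))).symm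
  · have hsum := hf a' b'
    rw [hbb', mul_zero, mul_zero, Finset.sum_eq_zero_iff_of_nonneg fun x _ => (hbound _).1] at hsum
    exact hsum j (Finset.mem_univ j)

theorem exists_scalar_of_isCorrectable {ι : Type*} [Fintype ι] (D : Decomposition A B K H)
    {Φ : QuantumOperation H} {E : ι → H →L[ℂ] H} (hE : HasErrorModel Φ E)
    (h : IsCorrectable D Φ) {a a' : A} (ha : ‖a‖ = 1) (i j : ι) :
    ∃ c : ℂ, ∀ b b', inner ℂ (E i (slice D a b)) (E j (slice D a' b')) = c * inner ℂ b b' := by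
  have : CompleteSpace B := FiniteDimensional.complete ℂ B
  obtain ⟨R, hR⟩ := h
  simp only [trA_conj_codeProj] at hR
  refine exists_inner_eq_of_orthogonal_preserving (E i ∘L slice D a) (E j ∘L slice D a')
    fun b b' hbb' => ?_
  rcases eq_or_ne b 0 with rfl | hb
  · simp
  · have h := inner_error_eq_zero_of_correctable D hE hR ha (a' := a')
      (norm_smul_inv_norm (𝕜 := ℂ) hb) (b' := b') (by simp [hbb']) i j
    simpa [inner_smul_left, hb] using h

theorem isCorrectable_of_exists_scalar {ι : Type*} [Fintype ι] {m : ℕ} (D : Decomposition A B K H)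
    (α : OrthonormalBasis (Fin m) ℂ A)
    {Φ : QuantumOperation H} {E : ι → H →L[ℂ] H} (hE : HasErrorModel Φ E)
    (h : ∀ (i j : ι) (k l : Fin m), ∃ c : ℂ, ∀ b b',
      inner ℂ (E i (slice D (α k) b)) (E j (slice D (α l) b')) = c * inner ℂ b b') :
    IsCorrectable D Φ := by
  have : CompleteSpace B := FiniteDimensional.complete ℂ B
  -- if `A ⊗ B` is zero there is no unit vector to build a recovery from, but nothing to restore
  rcases subsingleton_or_nontrivial (A ⊗[ℂ] B) with hAB | hAB
  · have h0 : ∀ T : H →L[ℂ] H, trA D T = 0 := by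
      intro T
      have : proj D ∘L T ∘L incl D = 0 := by ext x; exact Subsingleton.elim _ _
      rw [trA, this, map_zero]
    exact ⟨Φ, fun σ _ => by rw [h0, h0]⟩
  have hB : Nontrivial B := by
    by_contra hB
    rw [not_nontrivial_iff_subsingleton] at hB
    exact not_subsingleton (A ⊗[ℂ] B) inferInstance
  have hA : Nontrivial A := by
    by_contra hA
    rw [not_nontrivial_iff_subsingleton] at hA
    exact not_subsingleton (A ⊗[ℂ] B) inferInstance
  obtain ⟨a₀, ha₀⟩ := exists_norm_eq A zero_le_one
  have ha₀' : inner ℂ a₀ a₀ = (1 : ℂ) := by simp [inner_self_eq_norm_sq_to_K, ha₀]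
  obtain ⟨n, F, c, hF, hc⟩ := exists_kraus_of_scalar_gram
    (fun p : ι × Fin m => E p.1 ∘L slice D (α p.2)) (fun p q => h _ _ _ _) (slice D a₀)
    fun b b' => by rw [inner_slice_slice, ha₀', one_mul]
  simp only [comp_apply] at hc
  refine ⟨krausOperation F hF, ?_⟩
  simp only [trA_conj_codeProj]
  have hgen : ∀ k l b b', trA D (krausOperation F hF (Φ
      (rankOne ℂ (slice D (α k) b) (slice D (α l) b')))) =
      trA D (rankOne ℂ (slice D (α k) b) (slice D (α l) b')) := by
    intro k l b b'
    -- the Kraus operators of the recovery and `Φ` both preserve the trace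
    have hcoef : ∑ j, ∑ i, star (c (i, l) j) * c (i, k) j = inner ℂ (α l) (α k) := by
      obtain ⟨b₀, hb₀⟩ := exists_norm_eq B zero_le_one
      have hb₀' : inner ℂ b₀ b₀ = (1 : ℂ) := by simp [inner_self_eq_norm_sq_to_K, hb₀]
      have hisom : ∀ x y, ∑ j, inner ℂ (F j x) (F j y) = inner ℂ x y := by
        intro x y
        have := congrArg (fun T => inner ℂ x (T y)) hF
        simpa [adjoint_inner_right, inner_sum] using this
      have h1 := hE.sum_inner (slice D (α l) b₀) (slice D (α k) b₀)
      simp only [← hisom (E _ _)] at h1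
      rw [Finset.sum_comm, inner_slice_slice, hb₀', mul_one] at h1
      rw [← h1]
      refine Finset.sum_congr rfl fun j _ => Finset.sum_congr rfl fun i _ => ?_
      rw [hc (i, l), hc (i, k), inner_smul_left, inner_smul_right, inner_slice_slice, ha₀', hb₀']
      simp
    have hR : krausOperation F hF (Φ (rankOne ℂ (slice D (α k) b) (slice D (α l) b'))) =
        (inner ℂ (α l) (α k) : ℂ) • rankOne ℂ (slice D a₀ b) (slice D a₀ b') := by
      rw [krausOperation_apply, hE.apply_rankOne, ← hcoef, Finset.sum_smul]
      refine Finset.sum_congr rfl fun j _ => ?_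
      rw [Finset.mul_sum, Finset.sum_mul, Finset.sum_smul]
      refine Finset.sum_congr rfl fun i _ => ?_
      rw [conj_rankOne, hc (i, k), hc (i, l)]
      simp [smul_smul, mul_comm]
    rw [hR, trA_rankOne_slice]
    change trALinear D _ = _
    rw [map_smul]
    change _ • trA D _ = _
    rw [trA_rankOne_slice, ha₀', one_smul]
  let L₁ := trALinear D ∘ₗ (krausOperation F hF).toLinearMap ∘ₗ Φ.toLinearMap
  have hL : Set.EqOn L₁ (trALinear D) (Submodule.span ℂ
      {T | ∃ k l b b', T = rankOne ℂ (slice D (α k) b) (slice D (α l) b')}) := by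
    refine LinearMap.eqOn_span ?_
    rintro _ ⟨k, l, b, b', rfl⟩
    exact hgen k l b b'
  exact fun σ hσ => hL (semigroup_subset_span D α hσ)

end Main

end OperatorQEC

end

theorem mainTheorem1 {A B K H ι : Type*}
    [NormedAddCommGroup A] [InnerProductSpace ℂ A] [FiniteDimensional ℂ A]
    [NormedAddCommGroup B] [InnerProductSpace ℂ B] [FiniteDimensional ℂ B]
    [NormedAddCommGroup K] [InnerProductSpace ℂ K]
    [NormedAddCommGroup H] [InnerProductSpace ℂ H] [FiniteDimensional ℂ H] [CompleteSpace H]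
    [Fintype ι] {m : ℕ}
    (D : OperatorQEC.Decomposition A B K H) (α : OrthonormalBasis (Fin m) ℂ A)
    (Φ : OperatorQEC.QuantumOperation H) (E : ι → H →L[ℂ] H)
    (hE : OperatorQEC.HasErrorModel Φ E) :
    OperatorQEC.IsCorrectable D Φ ↔
      ∃ c : ι → ι → Fin m → Fin m → ℂ, ∀ (a b : ι) (k l : Fin m),
        OperatorQEC.matrixUnit D α k k * ContinuousLinearMap.adjoint (E a) * E b *
            OperatorQEC.matrixUnit D α l l
          = c a b k l • OperatorQEC.matrixUnit D α k l := by
  have : CompleteSpace B := FiniteDimensional.complete ℂ B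
  simp only [OperatorQEC.matrixUnit_condition_iff]
  constructor
  · intro h
    choose c hc using fun a b k l => OperatorQEC.exists_scalar_of_isCorrectable D hE h
      (a := α k) (a' := α l) (α.norm_eq_one k) a b
    exact ⟨c, hc⟩
  · rintro ⟨c, hc⟩
    exact OperatorQEC.isCorrectable_of_exists_scalar D α hE fun a b k l => ⟨_, hc a b k l⟩
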